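/- Let $T>0$, let $(\Omega,\mathcal F,\mathbb P)$ be a probability space carrying a $J$-dimensional Brownian motion $B$ on $[0,T]$, and let $(\mathcal F_t)_{0\le t\le T}$ be the filtration generated by $B$ (up to $\mathbb P$-null sets). Let $f=(f^j)_{1\le j\le J}$ be a bounded $\mathcal F_T$-measurable random vector, let $x\in\mathbb R$, $\gamma>0$ and $U(y)=-\frac1\gamma e^{-\gamma y}$. Let $$H_t=\theta^0\mathbf 1_{\{0\}}(t)+\sum_{i=0}^{N-1}\theta^i\mathbf 1_{(t_i,t_{i+1}]}(t),\qquad 0=t_0<t_1<\dots<t_N=T,$$ be a bounded simple $J$-dimensional process, where $\theta^i$ is $\mathcal F_{t_i}$-measurable. For a simple process $G$, the *price process of $f$ under demand $G$*, with *pricing measure* $\mathbb P^G$, is a process $S^G$ such that $S^G_T=f$, the measure $\mathbb P^G\sim\mathbb P$ is a probability measure with $$\frac{d\mathbb P^G}{d\mathbb P}=\frac{U'\left(x-\int_0^TG_u\,dS^G_u\right)}{\mathbb E\left[U'\left(x-\int_0^TG_u\,dS^G_u\right)\right]},$$ and $S^G$ and $\int G\,dS^G$ are martingales on $[0,T]$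 under $\mathbb P^G$ (processes being identified up to modification). Then for every $\epsilon>0$ the price process $S^{\epsilon H}$ under demand $\epsilon H$ exists and is unique (up to modification), as is its pricing measure, and $$S^{\epsilon H}_t=S^0_t+\epsilon\,\mathbb E\left[\left.\gamma\int_t^TH_u\,d\langle S^0\rangle_u\,\right|\mathcal F_t\right]+\xi_t(\epsilon),\qquad t\in[0,T].$$ Here $S^0_t=\mathbb E[f\mid\mathcal F_t]$, which is the price process under zero demand; $\langle S^0\rangle=(\langle S^{0,j},S^{0,k}\rangle)_{j,k}$ is the matrix of covariation processes, the $j$-th component of $\int_t^TH_u\,d\langle S^0\rangle_u$ is the (integrable) random variable $\sum_{k=1}^J\int_t^TH^k_u\,d\langle S^{0,j},S^{0,k}\rangle_u$; and $$\lim_{\epsilon\downarrow0}\frac{\xi_t(\epsilon)}{\epsilon}=0\quad\text{in probability, for every }t\in[0,T].$$ -/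

import Mathlib

open MeasureTheory ProbabilityTheory Filter Topology
open scoped NNReal ENNReal

namespace LargeInvestor

variable {Ω : Type*} {mΩ : MeasurableSpace Ω} {J : ℕ}

/-- The σ-algebra `σ(B_r : r ≤ t)` generated by the first `t` units of time of a `J`-dimensional
process `B`, given by its components. -/
@[reducible]
def pastSigma (B : Fin J → ℝ≥0 → Ω → ℝ) (t : ℝ≥0) : MeasurableSpace Ω :=
  ⨆ r ∈ Set.Iic t, ⨆ j, MeasurableSpace.comap (B j r) inferInstance

/-- `B` is a standard `J`-dimensional Brownian motion on the time interval `[0, T]`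
(its values at times later than `T` play no role). -/
structure IsBrownianOn (P : Measure Ω) (T : ℝ≥0) (B : Fin J → ℝ≥0 → Ω → ℝ) : Prop where
  measurable : ∀ j, ∀ t ≤ T, Measurable (B j t)
  start_zero : ∀ j, ∀ᵐ ω ∂P, B j 0 ω = 0
  law_increment : ∀ s t, s ≤ t → t ≤ T →
    P.map (fun ω j ↦ B j t ω - B j s ω) = Measure.pi fun _ ↦ gaussianReal 0 (t - s)
  indep_increment : ∀ s t, s ≤ t → t ≤ T →
    Indep (MeasurableSpace.comap (fun ω j ↦ B j t ω - B j s ω) inferInstance) (pastSigma B s) P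
  continuous_paths : ∀ j, ∀ᵐ ω ∂P, ContinuousOn (fun t ↦ B j t ω) (Set.Iic T)

/-- On `[0, T]` the filtration `𝓕` is generated by `B`, up to `P`-null sets. Both the raw filtration
`σ(B_r : r ≤ t)` and its augmentation by null sets satisfy this. -/
def IsGeneratedBy (P : Measure Ω) (T : ℝ≥0) (𝓕 : Filtration ℝ≥0 mΩ)
    (B : Fin J → ℝ≥0 → Ω → ℝ) : Prop :=
  ∀ t ≤ T, pastSigma B t ≤ 𝓕 t ∧
    ∀ s, MeasurableSet[𝓕 t] s → ∃ s', MeasurableSet[pastSigma B t] s' ∧ s =ᵐ[P] s'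

/-- `M` is a `μ`-martingale on the time interval `[0, T]`. -/
def IsMartingaleOn (μ : Measure Ω) (𝓕 : Filtration ℝ≥0 mΩ) (T : ℝ≥0) (M : ℝ≥0 → Ω → ℝ) : Prop :=
  Martingale (fun t ↦ M (min t T)) 𝓕 μ

/-- A simple `J`-dimensional demand process
`H_t = θ⁰ 1_{0}(t) + ∑_{i < N} θⁱ 1_{(t_i, t_{i+1}]}(t)` on `[0, T]`, where
`0 = t_0 < ⋯ < t_N = T` and `θⁱ` is `𝓕_{t_i}`-measurable. -/
structure SimpleDemand (𝓕 : Filtration ℝ≥0 mΩ) (T : ℝ≥0) (J : ℕ) where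
  /-- the number of intervals -/
  N : ℕ
  /-- the partition points -/
  time : Fin (N + 1) → ℝ≥0
  time_strictMono : StrictMono time
  time_zero : time 0 = 0
  time_last : time (Fin.last N) = T
  /-- `θ i j` is the position in asset `j` on the interval `(t_i, t_{i+1}]` -/
  θ : Fin N → Fin J → Ω → ℝ
  measurable_θ : ∀ i j, Measurable[𝓕 (time i.castSucc)] (θ i j)

namespace SimpleDemand

variable {𝓕 : Filtration ℝ≥0 mΩ} {T : ℝ≥0}

/-- The scaled demand `ε H`. -/
def scale (ε : ℝ) (H : SimpleDemand 𝓕 T J) : SimpleDemand 𝓕 T J where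
  N := H.N
  time := H.time
  time_strictMono := H.time_strictMono
  time_zero := H.time_zero
  time_last := H.time_last
  θ i j ω := ε * H.θ i j ω
  measurable_θ i j := (H.measurable_θ i j).const_mul ε

/-- The demand is (essentially) bounded. -/
def IsBounded (P : Measure Ω) (H : SimpleDemand 𝓕 T J) : Prop :=
  ∃ C : ℝ, ∀ i j, ∀ᵐ ω ∂P, |H.θ i j ω| ≤ C

/-- The integral `∫_s^t H^k_u dA_u = ∑_i θ^{i,k} (A_{t_{i+1}} - A_{t_i})`, with `t_i`, `t_{i+1}`
clamped to `[s, t]`, of the `k`-th component of a simple process. It is the usual stochastic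
integral when `A` is a semimartingale, and the Lebesgue-Stieltjes integral when `A` is continuous
and of bounded variation. -/
def integral (H : SimpleDemand 𝓕 T J) (k : Fin J) (A : ℝ≥0 → Ω → ℝ) (s t : ℝ≥0) (ω : Ω) : ℝ :=
  ∑ i : Fin H.N, H.θ i k ω *
    (A (max s (min (H.time i.succ) t)) ω - A (max s (min (H.time i.castSucc) t)) ω)

/-- The gains `∫_0^t H_u dS_u = ∑_k ∫_0^t H^k_u dS^k_u` from trading at the prices `S`. -/
def gain (H : SimpleDemand 𝓕 T J) (S : Fin J → ℝ≥0 → Ω → ℝ) (t : ℝ≥0) (ω : Ω) : ℝ :=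
  ∑ k, H.integral k (S k) 0 t ω

end SimpleDemand

/-- The exponential utility `U(x) = - e^{-γ x} / γ`. -/
noncomputable def expUtility (γ : ℝ) (x : ℝ) : ℝ := -(1 / γ) * Real.exp (-γ * x)

/-- `Q` is the pricing measure and `S` the price process of the claim `f` under the demand `H`, for
a market maker with utility `U` and initial cash `x`: `Q` is a probability measure equivalent to `P`
with density `U'(x - ∫_0^T H dS) / E[U'(x - ∫_0^T H dS)]`, the terminal price is `f`, and `S` and
`∫ H dS` are `Q`-martingales on `[0, T]`.

No regularity of paths is demanded, so that every modification of a price process is again one;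
since martingales of a Brownian filtration have continuous modifications, one of these is a
semimartingale. -/
structure IsPriceProcess (P : Measure Ω) {𝓕 : Filtration ℝ≥0 mΩ} {T : ℝ≥0} (U : ℝ → ℝ) (x : ℝ)
    (f : Fin J → Ω → ℝ) (H : SimpleDemand 𝓕 T J) (Q : Measure Ω)
    (S : Fin J → ℝ≥0 → Ω → ℝ) : Prop where
  isProbabilityMeasure : IsProbabilityMeasure Q
  absolutelyContinuous : Q ≪ P
  absolutelyContinuous' : P ≪ Q
  integrable_marginal : Integrable (fun ω ↦ deriv U (x - H.gain S T ω)) P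
  density : Q = P.withDensity fun ω ↦
    ENNReal.ofReal (deriv U (x - H.gain S T ω) / ∫ ω', deriv U (x - H.gain S T ω') ∂P)
  terminal : ∀ j, S j T =ᵐ[P] f j
  martingale_price : ∀ j, IsMartingaleOn Q 𝓕 T (S j)
  martingale_gain : IsMartingaleOn Q 𝓕 T (H.gain S)

/-- `A` is (a version of) the covariation `⟨M, N⟩` on `[0, T]` of the square integrable
martingales `M`, `N` of a Brownian filtration: the continuous adapted process of bounded variation,
starting at zero, for which `M N - A` is a martingale. It is unique up to indistinguishability. -/
structure IsCovariation (P : Measure Ω) (𝓕 : Filtration ℝ≥0 mΩ) (T : ℝ≥0)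
    (M N A : ℝ≥0 → Ω → ℝ) : Prop where
  adapted : ∀ t ≤ T, Measurable[𝓕 t] (A t)
  start_zero : ∀ᵐ ω ∂P, A 0 ω = 0
  continuous_paths : ∀ᵐ ω ∂P, ContinuousOn (fun t ↦ A t ω) (Set.Iic T)
  boundedVariation : ∀ᵐ ω ∂P, BoundedVariationOn (fun t ↦ A t ω) (Set.Iic T)
  martingale : IsMartingaleOn P 𝓕 T fun t ω ↦ M t ω * N t ω - A t ω

/-- The process `S⁰_t = E[f | 𝓕_t]`. -/
noncomputable def zeroPrice (P : Measure Ω) (𝓕 : Filtration ℝ≥0 mΩ) (f : Fin J → Ω → ℝ)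
    (j : Fin J) (t : ℝ≥0) : Ω → ℝ :=
  P[f j | 𝓕 t]

/-- The `j`-th component `∑_k ∫_t^T H^k_u d⟨S^j, S^k⟩_u` of `∫_t^T H_u d⟨S⟩_u`, where
`A j k` is `⟨S^j, S^k⟩`. -/
def bracketIntegral {𝓕 : Filtration ℝ≥0 mΩ} {T : ℝ≥0} (H : SimpleDemand 𝓕 T J)
    (A : Fin J → Fin J → ℝ≥0 → Ω → ℝ) (j : Fin J) (t : ℝ≥0) (ω : Ω) : ℝ :=
  ∑ k, H.integral k (A j k) t T ω

end LargeInvestor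

/-!
With exponential utility the cash of the market maker cancels out of the pricing density, so the
pricing measure under a demand `G` is the exponential tilt `P.tilted (γ * ∫ G dS)`, and the price is
the conditional expectation of the claim under it. Prices are then bounded like the claim, and so is
the exponent of the density.

*Existence and uniqueness.* Tilting by a factor known at the time of conditioning does not change
conditional expectations (`condExp_tilted_add`). Hence the price at a partition point `t_i` depends
only on the trades made from `t_i` on, and in `θ_i · (S_{t_{i+1}} - S_{t_i})` the term with the
unknown price `S_{t_i}` can be dropped as well. So the prices at the later partition points determine
the price at `t_i`, and backward recursion gives existence (`exists_isGridPrice`) and uniqueness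
(`IsGridPrice.logWeight_ae_eq`) of the density, which in turn gives the prices at all times.

*The expansion.* Let `g = γ ε ∫_0^T H dS^ε`. Since `f - S^ε_t` is conditionally orthogonal to `e^g`,
`S^ε_t - S⁰_t = E[(f - S^ε_t) (e^g - 1) | 𝓕_t]` (`sub_condExp_ae_eq`). As `g` is uniformly of order
`ε`, so is `S^ε - S⁰`; inserting this once more gives
`S^ε_t - S⁰_t = ε E[(f - S⁰_t) γ ∫_0^T H dS⁰ | 𝓕_t] + O(ε²)` uniformly
(`exists_abs_remainder_le`). Finally, because `S^{0,j} S^{0,k} - ⟨S^{0,j}, S^{0,k}⟩` is a martingale,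
the conditional covariance of `f` with the gains at the prices `S⁰` is the conditional expectation
of the integral against the covariation over `[t, T]` (`condExp_sub_mul_gain_zeroPrice`).
-/

namespace LargeInvestor

/-! ### Essentially bounded functions and exponential tilting -/

section Tilting

variable {Ω : Type*} {m mΩ : MeasurableSpace Ω} {μ : Measure Ω}

lemma exists_ae_abs_le {g : Ω → ℝ} (hg : MemLp g ∞ μ) : ∃ K : ℝ, 0 ≤ K ∧ ∀ᵐ ω ∂μ, |g ω| ≤ K := by
  refine ⟨(eLpNormEssSup g μ).toReal, ENNReal.toReal_nonneg, ?_⟩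
  have hfin : eLpNormEssSup g μ ≠ ∞ := by
    have := hg.2
    rw [eLpNorm_exponent_top] at this
    exact this.ne
  filter_upwards [ae_le_eLpNormEssSup (f := g) (μ := μ)] with ω hω
  have := ENNReal.toReal_mono hfin hω
  simpa using this

lemma memLp_top_mul {g h : Ω → ℝ} (hg : MemLp g ∞ μ) (hh : MemLp h ∞ μ) :
    MemLp (fun ω ↦ g ω * h ω) ∞ μ := MemLp.mul' hh hg

lemma memLp_top_exp {g : Ω → ℝ} (hg : MemLp g ∞ μ) :
    MemLp (fun ω ↦ Real.exp (g ω)) ∞ μ := by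
  obtain ⟨K, -, hK⟩ := exists_ae_abs_le hg
  refine memLp_top_of_bound (Real.continuous_exp.comp_aestronglyMeasurable hg.1) (Real.exp K) ?_
  filter_upwards [hK] with ω hω
  rw [Real.norm_eq_abs, Real.abs_exp]
  exact Real.exp_le_exp.2 ((le_abs_self _).trans hω)

lemma memLp_top_mono_ac {ν : Measure Ω} (hνμ : ν ≪ μ) {g : Ω → ℝ} (hg : MemLp g ∞ μ) :
    MemLp g ∞ ν := by
  obtain ⟨K, -, hK⟩ := exists_ae_abs_le hg
  exact memLp_top_of_bound (hg.1.mono_ac hνμ) K (hνμ hK)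

lemma memLp_top_integrable [IsFiniteMeasure μ] {g : Ω → ℝ} (hg : MemLp g ∞ μ) :
    Integrable g μ := hg.integrable le_top

lemma integrable_exp_of_memLp_top [IsFiniteMeasure μ] {g : Ω → ℝ} (hg : MemLp g ∞ μ) :
    Integrable (fun ω ↦ Real.exp (g ω)) μ := memLp_top_integrable (memLp_top_exp hg)

lemma memLp_top_condExp [IsProbabilityMeasure μ] {g : Ω → ℝ}
    (hg : MemLp g ∞ μ) : MemLp (μ[g | m]) ∞ μ := hg.condExp le_top

lemma ae_abs_condExp_le {g : Ω → ℝ} {K : ℝ} (hK : ∀ᵐ ω ∂μ, |g ω| ≤ K) :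
    ∀ᵐ ω ∂μ, |(μ[g | m]) ω| ≤ K := ae_bdd_abs_condExp_of_ae_bdd_abs hK

/-- Tilting by a function that is already known at the time of conditioning does not change
conditional expectations. -/
lemma condExp_tilted_of_stronglyMeasurable [IsProbabilityMeasure μ] (hm : m ≤ mΩ) {v Y : Ω → ℝ}
    (hv : StronglyMeasurable[m] v) (hvb : MemLp v ∞ μ) (hY : MemLp Y ∞ μ) :
    (μ.tilted v)[Y | m] =ᵐ[μ] μ[Y | m] := by
  have hexp := integrable_exp_of_memLp_top hvb
  have hac : μ.tilted v ≪ μ := tilted_absolutelyContinuous μ v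
  have : IsProbabilityMeasure (μ.tilted v) := isProbabilityMeasure_tilted hexp
  refine (absolutelyContinuous_tilted hexp).ae_le (EventuallyEq.symm ?_)
  have hc := memLp_top_condExp (m := m) hY
  refine ae_eq_condExp_of_forall_setIntegral_eq hm
    (memLp_top_integrable (memLp_top_mono_ac hac hY))
    (fun s _ _ ↦ (memLp_top_integrable (memLp_top_mono_ac hac hc)).integrableOn) ?_
    stronglyMeasurable_condExp.aestronglyMeasurable
  intro s hs _
  rw [setIntegral_tilted, setIntegral_tilted]
  set c := ∫ ω, Real.exp (v ω) ∂μ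
  have hw : StronglyMeasurable[m] fun ω ↦ Real.exp (v ω) / c := by
    simp only [div_eq_mul_inv]
    exact (Real.continuous_exp.comp_stronglyMeasurable hv).mul stronglyMeasurable_const
  have hwb : MemLp (fun ω ↦ Real.exp (v ω) / c) ∞ μ := by
    simpa only [div_eq_mul_inv] using (memLp_top_exp hvb).mul_const c⁻¹
  have hwY := memLp_top_integrable (memLp_top_mul hwb hY)
  rw [← setIntegral_condExp hm (f := fun ω ↦ (Real.exp (v ω) / c) • Y ω) hwY hs]
  refine setIntegral_congr_ae (hm s hs) ?_
  filter_upwards [condExp_mul_of_stronglyMeasurable_left hw hwY (memLp_top_integrable hY)]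
    with ω hω _
  exact hω.symm

lemma memLp_condExp_tilted [IsProbabilityMeasure μ] {g Y : Ω → ℝ}
    (hg : MemLp g ∞ μ) (hY : MemLp Y ∞ μ) : MemLp ((μ.tilted g)[Y | m]) ∞ μ := by
  have hexp := integrable_exp_of_memLp_top hg
  have : IsProbabilityMeasure (μ.tilted g) := isProbabilityMeasure_tilted hexp
  exact memLp_top_mono_ac (absolutelyContinuous_tilted hexp)
    (memLp_top_condExp (memLp_top_mono_ac (tilted_absolutelyContinuous μ g) hY))

/-- The part of a tilt that is known at the time of conditioning can be dropped. -/
lemma condExp_tilted_add [IsProbabilityMeasure μ] (hm : m ≤ mΩ) {g v Y : Ω → ℝ}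
    (hg : MemLp g ∞ μ) (hv : StronglyMeasurable[m] v) (hvb : MemLp v ∞ μ) (hY : MemLp Y ∞ μ) :
    (μ.tilted (g + v))[Y | m] =ᵐ[μ] (μ.tilted g)[Y | m] := by
  have hexp := integrable_exp_of_memLp_top hg
  have hac : μ.tilted g ≪ μ := tilted_absolutelyContinuous μ g
  have : IsProbabilityMeasure (μ.tilted g) := isProbabilityMeasure_tilted hexp
  rw [← tilted_tilted hexp]
  exact (absolutelyContinuous_tilted hexp).ae_le
    (condExp_tilted_of_stronglyMeasurable hm hv (memLp_top_mono_ac hac hvb)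
      (memLp_top_mono_ac hac hY))

/-- If `X` is the conditional expectation of `Y` under the measure tilted by `g`, then the error
`Y - X` is conditionally orthogonal to `e ^ g` under the original measure. -/
lemma condExp_sub_mul_exp_eq_zero [IsProbabilityMeasure μ] (hm : m ≤ mΩ) {g X Y : Ω → ℝ}
    (hg : MemLp g ∞ μ) (hX : MemLp X ∞ μ) (hY : MemLp Y ∞ μ)
    (hXY : X =ᵐ[μ] (μ.tilted g)[Y | m]) :
    μ[fun ω ↦ (Y ω - X ω) * Real.exp (g ω) | m] =ᵐ[μ] 0 := by
  have hexp := integrable_exp_of_memLp_top hg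
  have hac : μ.tilted g ≪ μ := tilted_absolutelyContinuous μ g
  have : IsProbabilityMeasure (μ.tilted g) := isProbabilityMeasure_tilted hexp
  have hc : 0 < ∫ ω, Real.exp (g ω) ∂μ := integral_exp_pos hexp
  refine EventuallyEq.symm (ae_eq_condExp_of_forall_setIntegral_eq hm
    (memLp_top_integrable (memLp_top_mul (hY.sub hX) (memLp_top_exp hg)))
    (fun s _ _ ↦ (integrable_zero _ _ _).integrableOn) ?_ aestronglyMeasurable_zero)
  intro s hs _
  have hYQ := memLp_top_integrable (memLp_top_mono_ac hac hY)
  have hXQ := memLp_top_integrable (memLp_top_mono_ac hac hX)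
  have h1 : ∫ ω in s, (Y ω - X ω) ∂(μ.tilted g) = 0 := by
    rw [integral_sub hYQ.integrableOn hXQ.integrableOn, sub_eq_zero,
      ← setIntegral_condExp hm hYQ hs]
    refine setIntegral_congr_ae (hm s hs) ?_
    filter_upwards [hac.ae_le hXY] with ω hω _ using hω.symm
  rw [setIntegral_tilted] at h1
  have h2 : ∀ ω, (Real.exp (g ω) / ∫ ω, Real.exp (g ω) ∂μ) • (Y ω - X ω)
      = (∫ ω, Real.exp (g ω) ∂μ)⁻¹ * ((Y ω - X ω) * Real.exp (g ω)) := by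
    intro ω; rw [smul_eq_mul]; ring
  simp_rw [h2] at h1
  rw [integral_const_mul] at h1
  simpa using (mul_eq_zero.1 h1).resolve_left (inv_ne_zero hc.ne') |>.symm

end Tilting

/-! ### The backward recursion on a time grid -/

section Recursion

variable {Ω : Type*} {mΩ : MeasurableSpace Ω} {J : ℕ}

/-- The exponent `∑_{i ≤ k < N} ϑ_k · (s_{k+1} - s_k)` contributed to the pricing density by the
trades made from the `i`-th grid point onwards. -/
def logWeight (ϑ s : ℕ → Fin J → Ω → ℝ) (N i : ℕ) : Ω → ℝ :=
  ∑ k ∈ Finset.Ico i N, ∑ j, fun ω ↦ ϑ k j ω * (s (k + 1) j ω - s k j ω)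

/-- `s` is a price process on the grid points `τ_i, …, τ_N`: at each of them it is the conditional
expectation of `f` under the measure whose density has exponent `logWeight ϑ s N i`. Only the trades
after `τ_i` enter; the earlier ones are known there and do not influence the prices. -/
structure IsGridPrice (P : Measure Ω) (𝓕 : Filtration ℝ≥0 mΩ) (τ : ℕ → ℝ≥0)
    (ϑ : ℕ → Fin J → Ω → ℝ) (f : Fin J → Ω → ℝ) (N i : ℕ) (s : ℕ → Fin J → Ω → ℝ) : Prop where
  stronglyMeasurable : ∀ k j, StronglyMeasurable[𝓕 (τ k)] (s k j)
  memLp : ∀ k j, MemLp (s k j) ∞ P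
  price : ∀ k, i ≤ k → k ≤ N → ∀ j,
    s k j =ᵐ[P] (P.tilted (logWeight ϑ s N i))[f j | 𝓕 (τ k)]

variable {P : Measure Ω} {𝓕 : Filtration ℝ≥0 mΩ} {τ : ℕ → ℝ≥0} {ϑ : ℕ → Fin J → Ω → ℝ}
  {f : Fin J → Ω → ℝ} {N : ℕ}

lemma memLp_inner {a b : Fin J → Ω → ℝ} (ha : ∀ j, MemLp (a j) ∞ P) (hb : ∀ j, MemLp (b j) ∞ P) :
    MemLp (∑ j, fun ω ↦ a j ω * b j ω) ∞ P :=
  memLp_finsetSum' _ fun j _ ↦ memLp_top_mul (ha j) (hb j)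

lemma stronglyMeasurable_inner {m : MeasurableSpace Ω} {a b : Fin J → Ω → ℝ}
    (ha : ∀ j, StronglyMeasurable[m] (a j)) (hb : ∀ j, StronglyMeasurable[m] (b j)) :
    StronglyMeasurable[m] (∑ j, fun ω ↦ a j ω * b j ω) :=
  Finset.stronglyMeasurable_sum _ fun j _ ↦ (ha j).mul (hb j)

lemma memLp_logWeight (hϑ : ∀ k j, MemLp (ϑ k j) ∞ P) {s : ℕ → Fin J → Ω → ℝ}
    (hs : ∀ k j, MemLp (s k j) ∞ P) (i : ℕ) : MemLp (logWeight ϑ s N i) ∞ P :=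
  memLp_finsetSum' _ fun k _ ↦ memLp_inner (hϑ k) fun j ↦ (hs (k + 1) j).sub (hs k j)

/-- The exponent at the `i`-th grid point, split into a part that does not involve `s_i` and a part
that is known at time `τ_i`. -/
lemma logWeight_eq_add (s : ℕ → Fin J → Ω → ℝ) {i : ℕ} (hi : i < N) :
    logWeight ϑ s N i = (logWeight ϑ s N (i + 1) + ∑ j, fun ω ↦ ϑ i j ω * s (i + 1) j ω)
      + ∑ j, fun ω ↦ ϑ i j ω * (-s i j ω) := by
  rw [logWeight, Finset.sum_eq_sum_Ico_succ_bot hi, logWeight]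
  ext ω
  simp only [Pi.add_apply, Finset.sum_apply, mul_sub, mul_neg, Finset.sum_sub_distrib,
    Finset.sum_neg_distrib]
  ring

section

variable [IsProbabilityMeasure P]
  (hϑm : ∀ k j, StronglyMeasurable[𝓕 (τ k)] (ϑ k j)) (hϑ : ∀ k j, MemLp (ϑ k j) ∞ P)
  (hf : ∀ j, MemLp (f j) ∞ P)
include hϑm hϑ hf

/-- The price at `τ_i` can be computed from a tilt in which it does not appear: the term with `s_i`
in the exponent is known at time `τ_i`. -/
lemma condExp_tilted_logWeight_self {s : ℕ → Fin J → Ω → ℝ}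
    (hsm : ∀ k j, StronglyMeasurable[𝓕 (τ k)] (s k j)) (hs : ∀ k j, MemLp (s k j) ∞ P) {i : ℕ}
    (hi : i < N) (j : Fin J) :
    (P.tilted (logWeight ϑ s N i))[f j | 𝓕 (τ i)] =ᵐ[P]
      (P.tilted (logWeight ϑ s N (i + 1)
        + ∑ j, fun ω ↦ ϑ i j ω * s (i + 1) j ω))[f j | 𝓕 (τ i)] := by
  rw [logWeight_eq_add s hi]
  exact condExp_tilted_add (𝓕.le _)
    ((memLp_logWeight hϑ hs _).add (memLp_inner (hϑ i) (hs _)))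
    (stronglyMeasurable_inner (hϑm i) fun j ↦ (hsm i j).neg)
    (memLp_inner (hϑ i) fun j ↦ (hs _ j).neg) (hf j)

variable (hτ : Monotone τ)
include hτ

/-- From time `τ_{i+1}` on, the trade made at `τ_i` does not influence prices. -/
lemma condExp_tilted_logWeight_succ {s : ℕ → Fin J → Ω → ℝ}
    (hsm : ∀ k j, StronglyMeasurable[𝓕 (τ k)] (s k j)) (hs : ∀ k j, MemLp (s k j) ∞ P) {i : ℕ}
    (hi : i < N) {t : ℝ≥0} (ht : τ (i + 1) ≤ t) (j : Fin J) :
    (P.tilted (logWeight ϑ s N i))[f j | 𝓕 t]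
      =ᵐ[P] (P.tilted (logWeight ϑ s N (i + 1)))[f j | 𝓕 t] := by
  have hit : τ i ≤ t := (hτ i.le_succ).trans ht
  rw [logWeight_eq_add s hi, add_assoc]
  refine condExp_tilted_add (𝓕.le t) (memLp_logWeight hϑ hs _) ?_ ?_ (hf j)
  · refine (stronglyMeasurable_inner (fun j ↦ (hϑm i j).mono (𝓕.mono hit))
      fun j ↦ (hsm _ j).mono (𝓕.mono ht)).add
      (stronglyMeasurable_inner (fun j ↦ (hϑm i j).mono (𝓕.mono hit))
      fun j ↦ ((hsm _ j).mono (𝓕.mono hit)).neg)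
  · exact (memLp_inner (hϑ i) (hs _)).add (memLp_inner (hϑ i) fun j ↦ (hs _ j).neg)

lemma IsGridPrice.succ {s : ℕ → Fin J → Ω → ℝ} {i : ℕ} (hi : i < N)
    (h : IsGridPrice P 𝓕 τ ϑ f N i s) : IsGridPrice P 𝓕 τ ϑ f N (i + 1) s where
  stronglyMeasurable := h.stronglyMeasurable
  memLp := h.memLp
  price k hk hkN j := (h.price k (i.le_succ.trans hk) hkN j).trans
    (condExp_tilted_logWeight_succ hϑm hϑ hf hτ h.stronglyMeasurable h.memLp hi (hτ hk) j)

/-- Backward recursion: the prices on `τ_{i+1}, …, τ_N` determine the price at `τ_i`. -/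
lemma IsGridPrice.logWeight_ae_eq {s s' : ℕ → Fin J → Ω → ℝ} {i : ℕ} (hi : i ≤ N)
    (h : IsGridPrice P 𝓕 τ ϑ f N i s) (h' : IsGridPrice P 𝓕 τ ϑ f N i s') :
    logWeight ϑ s N i =ᵐ[P] logWeight ϑ s' N i := by
  induction hi using Nat.decreasingInduction with
  | self => simp [logWeight]
  | of_succ i hi ih =>
    have hi : i < N := hi
    have h1 := h.succ hϑm hϑ hf hτ hi
    have h1' := h'.succ hϑm hϑ hf hτ hi
    have hW := ih h1 h1'
    have hs1 : ∀ j, s (i + 1) j =ᵐ[P] s' (i + 1) j := fun j ↦ by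
      refine (h1.price _ le_rfl hi j).trans ?_
      rw [tilted_congr hW]
      exact (h1'.price _ le_rfl hi j).symm
    have hV : (logWeight ϑ s N (i + 1) + ∑ j, fun ω ↦ ϑ i j ω * s (i + 1) j ω) =ᵐ[P]
        (logWeight ϑ s' N (i + 1) + ∑ j, fun ω ↦ ϑ i j ω * s' (i + 1) j ω) := by
      filter_upwards [hW, ae_all_iff.2 hs1] with ω hω hω1
      simp [hω, hω1]
    have hs0 : ∀ j, s i j =ᵐ[P] s' i j := fun j ↦ by
      refine ((h.price _ le_rfl hi.le j).trans (condExp_tilted_logWeight_self hϑm hϑ hf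
        h.stronglyMeasurable h.memLp hi j)).trans ?_
      rw [tilted_congr hV]
      exact ((h'.price _ le_rfl hi.le j).trans (condExp_tilted_logWeight_self hϑm hϑ hf
        h'.stronglyMeasurable h'.memLp hi j)).symm
    rw [logWeight_eq_add s hi, logWeight_eq_add s' hi]
    filter_upwards [hV, ae_all_iff.2 hs0] with ω hω hω0
    rw [Pi.add_apply, hω, Pi.add_apply]
    simp [hω0]

/-- Backward recursion: prices on the grid exist. -/
lemma exists_isGridPrice {i : ℕ} (hi : i ≤ N) : ∃ s, IsGridPrice P 𝓕 τ ϑ f N i s := by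
  induction hi using Nat.decreasingInduction with
  | self =>
    refine ⟨fun k j ↦ P[f j | 𝓕 (τ k)], fun k j ↦ stronglyMeasurable_condExp,
      fun k j ↦ memLp_top_condExp (hf j), fun k _ _ j ↦ ?_⟩
    simp [logWeight]
  | of_succ i hi ih =>
    have hi : i < N := hi
    obtain ⟨s, h⟩ := ih
    have hV : MemLp (logWeight ϑ s N (i + 1) + ∑ j, fun ω ↦ ϑ i j ω * s (i + 1) j ω) ∞ P :=
      (memLp_logWeight hϑ h.memLp _).add (memLp_inner (hϑ i) (h.memLp _))
    set V := logWeight ϑ s N (i + 1) + ∑ j, fun ω ↦ ϑ i j ω * s (i + 1) j ω with hVdef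
    set s' := Function.update s i fun j ↦ (P.tilted V)[f j | 𝓕 (τ i)] with hs'
    have hne : ∀ k, i + 1 ≤ k → s' k = s k := fun k hk ↦
      Function.update_of_ne (by omega) _ _
    have hself : s' i = fun j ↦ (P.tilted V)[f j | 𝓕 (τ i)] := Function.update_self _ _ _
    have hsm : ∀ k j, StronglyMeasurable[𝓕 (τ k)] (s' k j) := fun k j ↦ by
      rcases eq_or_ne k i with rfl | hk
      · rw [hself]; exact stronglyMeasurable_condExp
      · rw [hs', Function.update_of_ne hk]; exact h.stronglyMeasurable k j
    have hsb : ∀ k j, MemLp (s' k j) ∞ P := fun k j ↦ by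
      rcases eq_or_ne k i with rfl | hk
      · rw [hself]; exact memLp_condExp_tilted hV (hf j)
      · rw [hs', Function.update_of_ne hk]; exact h.memLp k j
    have hW : logWeight ϑ s' N (i + 1) = logWeight ϑ s N (i + 1) := by
      refine Finset.sum_congr rfl fun k hk ↦ ?_
      have hk := (Finset.mem_Ico.1 hk).1
      rw [hne k hk, hne (k + 1) (by omega)]
    refine ⟨s', hsm, hsb, fun k hk hkN j ↦ ?_⟩
    rcases eq_or_lt_of_le hk with rfl | hk
    · refine EventuallyEq.trans ?_ (condExp_tilted_logWeight_self hϑm hϑ hf hsm hsb hi j).symm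
      rw [hself, hW, hne _ le_rfl]
    · refine EventuallyEq.trans ?_
        (condExp_tilted_logWeight_succ hϑm hϑ hf hτ hsm hsb hi (hτ hk) j).symm
      rw [hne k hk, hW]
      exact h.price k hk hkN j

end

end Recursion

/-! ### Gains from trading against bounded martingales -/

section Gains

variable {Ω : Type*} {mΩ : MeasurableSpace Ω} {μ P : Measure Ω} {𝓕 : Filtration ℝ≥0 mΩ}
  {T : ℝ≥0} {J : ℕ}

lemma condExp_martingale_min [IsFiniteMeasure μ] {M : ℝ≥0 → Ω → ℝ} (hM : Martingale M 𝓕 μ)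
    (v t : ℝ≥0) : μ[M v | 𝓕 t] =ᵐ[μ] M (min v t) := by
  rcases le_total t v with h | h
  · rw [min_eq_right h]; exact hM.2 t v h
  · rw [min_eq_left h, condExp_of_stronglyMeasurable (𝓕.le t) ((hM.1 v).mono (𝓕.mono h))
      (hM.integrable v)]

/-- Holding a bounded position, chosen at time `u`, in a bounded martingale over `(u, v]` yields a
martingale. -/
lemma martingale_mul_sub [IsFiniteMeasure μ] {M : ℝ≥0 → Ω → ℝ} (hM : Martingale M 𝓕 μ)
    (hMb : ∀ t, MemLp (M t) ∞ μ) {u v : ℝ≥0} (huv : u ≤ v) {θ : Ω → ℝ}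
    (hθ : StronglyMeasurable[𝓕 u] θ) (hθb : MemLp θ ∞ μ) :
    Martingale (fun t ω ↦ θ ω * (M (min v t) ω - M (min u t) ω)) 𝓕 μ := by
  -- past `u` the position is known and can be pulled out
  have key : ∀ t, u ≤ t → μ[fun ω ↦ θ ω * (M v ω - M u ω) | 𝓕 t]
      =ᵐ[μ] fun ω ↦ θ ω * (M (min v t) ω - M (min u t) ω) := fun t ht ↦ by
    have h1 := condExp_mul_of_stronglyMeasurable_left (hθ.mono (𝓕.mono ht))
      (memLp_top_integrable (memLp_top_mul hθb ((hMb v).sub (hMb u))))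
      (memLp_top_integrable ((hMb v).sub (hMb u)))
    refine EventuallyEq.trans h1 ?_
    filter_upwards [condExp_sub (memLp_top_integrable (hMb v)) (memLp_top_integrable (hMb u))
      (𝓕 t), condExp_martingale_min hM v t, condExp_martingale_min hM u t] with ω h2 h3 h4
    rw [Pi.mul_apply, h2, Pi.sub_apply, h3, h4]
  have hZ : ∀ t, μ[fun ω ↦ θ ω * (M v ω - M u ω) | 𝓕 t]
      =ᵐ[μ] fun ω ↦ θ ω * (M (min v t) ω - M (min u t) ω) := fun t ↦ by
    rcases le_total u t with ht | ht
    · exact key t ht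
    -- before `u` there are no gains: condition on `𝓕 u` first
    · have h0 : μ[fun ω ↦ θ ω * (M v ω - M u ω) | 𝓕 u] =ᵐ[μ] 0 := by
        refine (key u le_rfl).trans (Eventually.of_forall fun ω ↦ ?_)
        simp [huv]
      refine (condExp_condExp_of_le (𝓕.mono ht) (𝓕.le u)).symm.trans
        ((condExp_congr_ae h0).trans (Eventually.of_forall fun ω ↦ ?_))
      simp [ht, ht.trans huv]
  refine ⟨fun t ↦ ?_, fun s t hst ↦ ?_⟩
  · rcases le_total u t with ht | ht
    · exact (hθ.mono (𝓕.mono ht)).mul (((hM.1 _).mono (𝓕.mono (min_le_right v t))).sub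
        ((hM.1 _).mono (𝓕.mono (min_le_right u t))))
    · simp only [min_eq_right ht, min_eq_right (ht.trans huv), sub_self, mul_zero]
      exact stronglyMeasurable_const
  · exact (condExp_congr_ae (hZ t)).symm.trans
      ((condExp_condExp_of_le (𝓕.mono hst) (𝓕.le t)).trans (hZ s))

lemma martingale_finset_sum {ι : Type*} (s : Finset ι) {M : ι → ℝ≥0 → Ω → ℝ}
    (hM : ∀ i ∈ s, Martingale (M i) 𝓕 μ) : Martingale (∑ i ∈ s, M i) 𝓕 μ :=
  Finset.sum_induction M (fun N ↦ Martingale N 𝓕 μ) (fun _ _ ↦ Martingale.add)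
    (martingale_zero ℝ 𝓕 μ) hM

namespace SimpleDemand

variable (H : SimpleDemand 𝓕 T J)

lemma time_le (i : Fin (H.N + 1)) : H.time i ≤ T :=
  (H.time_strictMono.monotone (Fin.le_last i)).trans_eq H.time_last

lemma time_castSucc_le (i : Fin H.N) : H.time i.castSucc ≤ H.time i.succ :=
  H.time_strictMono.monotone i.castSucc_lt_succ.le

lemma stronglyMeasurable_θ (i : Fin H.N) (j : Fin J) :
    StronglyMeasurable[𝓕 (H.time i.castSucc)] (H.θ i j) := (H.measurable_θ i j).stronglyMeasurable

variable {H}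

lemma IsBounded.memLp (hH : H.IsBounded P) (i : Fin H.N) (j : Fin J) : MemLp (H.θ i j) ∞ P := by
  obtain ⟨C, hC⟩ := hH
  exact memLp_top_of_bound ((H.stronglyMeasurable_θ i j).mono (𝓕.le _)).aestronglyMeasurable C
    (hC i j)

lemma IsBounded.scale (hH : H.IsBounded P) (ε : ℝ) : (H.scale ε).IsBounded P := by
  obtain ⟨C, hC⟩ := hH
  refine ⟨|ε| * C, fun i j ↦ ?_⟩
  filter_upwards [hC i j] with ω hω
  change |ε * H.θ i j ω| ≤ _
  rw [abs_mul]
  exact mul_le_mul_of_nonneg_left hω (abs_nonneg ε)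

lemma gain_scale (ε : ℝ) (S : Fin J → ℝ≥0 → Ω → ℝ) (t : ℝ≥0) (ω : Ω) :
    (H.scale ε).gain S t ω = ε * H.gain S t ω := by
  simp only [gain, integral, Finset.mul_sum, ← mul_assoc]
  rfl

lemma gain_final (S : Fin J → ℝ≥0 → Ω → ℝ) (ω : Ω) :
    H.gain S T ω = ∑ k, ∑ i : Fin H.N,
      H.θ i k ω * (S k (H.time i.succ) ω - S k (H.time i.castSucc) ω) := by
  simp [gain, integral, H.time_le]

lemma memLp_gain (hH : H.IsBounded P) {S : Fin J → ℝ≥0 → Ω → ℝ}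
    (hS : ∀ j, ∀ t ≤ T, MemLp (S j t) ∞ P) : MemLp (H.gain S T) ∞ P := by
  have : H.gain S T = fun ω ↦ ∑ k, ∑ i : Fin H.N,
      H.θ i k ω * (S k (H.time i.succ) ω - S k (H.time i.castSucc) ω) := by
    ext ω; exact gain_final S ω
  rw [this]
  exact memLp_finsetSum _ fun k _ ↦ memLp_finsetSum _ fun i _ ↦ memLp_top_mul (hH.memLp i k)
    ((hS _ _ (H.time_le _)).sub (hS _ _ (H.time_le _)))

lemma isMartingaleOn_gain [IsFiniteMeasure μ] (hH : H.IsBounded μ) {S : Fin J → ℝ≥0 → Ω → ℝ}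
    (hS : ∀ j, IsMartingaleOn μ 𝓕 T (S j)) (hSb : ∀ j, ∀ t ≤ T, MemLp (S j t) ∞ μ) :
    IsMartingaleOn μ 𝓕 T (H.gain S) := by
  have h := martingale_finset_sum Finset.univ fun k _ ↦ martingale_finset_sum
    (Finset.univ : Finset (Fin H.N)) fun i _ ↦ martingale_mul_sub (hS k)
      (fun t ↦ hSb k _ (min_le_right _ _)) (H.time_castSucc_le i) (H.stronglyMeasurable_θ i k)
      (hH.memLp i k)
  have heq : (fun t ↦ H.gain S (min t T)) = ∑ k, ∑ i : Fin H.N, fun t ω ↦ H.θ i k ω *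
      (S k (min (min (H.time i.succ) t) T) ω - S k (min (min (H.time i.castSucc) t) T) ω) := by
    ext t ω
    simp [gain, integral, Finset.sum_apply, min_assoc]
  rw [IsMartingaleOn, heq]
  exact h

/-- The partition points, continued by `T`. -/
def gridTime (H : SimpleDemand 𝓕 T J) (k : ℕ) : ℝ≥0 := H.time ⟨min k H.N, by omega⟩

/-- The positions of the demand, continued by `0`. -/
def gridPosition (H : SimpleDemand 𝓕 T J) (k : ℕ) (j : Fin J) : Ω → ℝ :=
  if h : k < H.N then H.θ ⟨k, h⟩ j else 0

lemma gridTime_mono : Monotone H.gridTime := fun _ _ hkl ↦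
  H.time_strictMono.monotone (Fin.mk_le_mk.2 (min_le_min_right _ hkl))

lemma stronglyMeasurable_gridPosition (k : ℕ) (j : Fin J) :
    StronglyMeasurable[𝓕 (H.gridTime k)] (H.gridPosition k j) := by
  unfold gridPosition
  split_ifs with h
  · have : H.gridTime k = H.time (Fin.castSucc ⟨k, h⟩) := by
      simp [gridTime, min_eq_left h.le]
    rw [this]
    exact H.stronglyMeasurable_θ _ j
  · exact stronglyMeasurable_zero

lemma memLp_gridPosition (hH : H.IsBounded P) (k : ℕ) (j : Fin J) :
    MemLp (H.gridPosition k j) ∞ P := by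
  unfold gridPosition
  split_ifs with h
  · exact hH.memLp _ j
  · exact MemLp.zero'

lemma mul_gain_eq_logWeight (γ : ℝ) (S : Fin J → ℝ≥0 → Ω → ℝ) :
    (fun ω ↦ γ * H.gain S T ω) = logWeight (fun k j ω ↦ γ * H.gridPosition k j ω)
      (fun k j ↦ S j (H.gridTime k)) H.N 0 := by
  ext ω
  rw [gain_final, Finset.sum_comm, logWeight, Nat.Ico_zero_eq_range, Finset.sum_range,
    Finset.mul_sum, Finset.sum_apply]
  refine Finset.sum_congr rfl fun i _ ↦ ?_
  rw [Finset.mul_sum, Finset.sum_apply]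
  refine Finset.sum_congr rfl fun j _ ↦ ?_
  have h1 : H.gridTime i = H.time i.castSucc := by
    simp only [gridTime, min_eq_left i.2.le]; rfl
  have h2 : H.gridTime (i + 1) = H.time i.succ := by
    simp only [gridTime, min_eq_left (Nat.succ_le_of_lt i.2)]; rfl
  simp only [h1, h2, gridPosition, i.2, dif_pos, mul_assoc]

end SimpleDemand

end Gains

/-! ### Price processes and tilted measures -/

section PriceProcess

variable {Ω : Type*} {mΩ : MeasurableSpace Ω} {P Q : Measure Ω} {𝓕 : Filtration ℝ≥0 mΩ}
  {T : ℝ≥0} {J : ℕ} {H : SimpleDemand 𝓕 T J} {f : Fin J → Ω → ℝ} {γ x : ℝ}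
  {S : Fin J → ℝ≥0 → Ω → ℝ}

lemma deriv_expUtility (hγ : γ ≠ 0) (y : ℝ) : deriv (expUtility γ) y = Real.exp (-γ * y) := by
  have h : HasDerivAt (expUtility γ) (-(1 / γ) * (Real.exp (-γ * y) * (-γ * 1))) y :=
    (((hasDerivAt_id y).const_mul (-γ)).exp).const_mul _
  rw [h.deriv]
  field_simp

lemma deriv_expUtility_sub (hγ : γ ≠ 0) (x y : ℝ) :
    deriv (expUtility γ) (x - y) = Real.exp (-γ * x) * Real.exp (γ * y) := by
  rw [deriv_expUtility hγ, ← Real.exp_add]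
  ring_nf

/-- With exponential utility, the cash of the market maker cancels out and the pricing measure is an
exponential tilt by the gains. -/
lemma withDensity_marginal_eq_tilted (hγ : γ ≠ 0) (x : ℝ) (G : Ω → ℝ) :
    (P.withDensity fun ω ↦ ENNReal.ofReal (deriv (expUtility γ) (x - G ω) /
      ∫ ω', deriv (expUtility γ) (x - G ω') ∂P)) = P.tilted fun ω ↦ γ * G ω := by
  simp only [deriv_expUtility_sub hγ, integral_const_mul, Measure.tilted]
  congr 1
  ext ω
  rw [mul_div_mul_left _ _ (Real.exp_pos _).ne']

lemma IsPriceProcess.eq_tilted (hγ : γ ≠ 0)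
    (h : IsPriceProcess P (expUtility γ) x f H Q S) : Q = P.tilted fun ω ↦ γ * H.gain S T ω :=
  h.density.trans (withDensity_marginal_eq_tilted hγ x _)

lemma IsPriceProcess.ae_eq_condExp (h : IsPriceProcess P (expUtility γ) x f H Q S) (j : Fin J)
    {t : ℝ≥0} (ht : t ≤ T) : S j t =ᵐ[P] Q[f j | 𝓕 t] := by
  refine h.absolutelyContinuous'.ae_le ?_
  have h1 := (h.martingale_price j).2 t T ht
  simp only [min_self, min_eq_left ht] at h1
  exact h1.symm.trans (condExp_congr_ae (h.absolutelyContinuous.ae_le (h.terminal j)))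

lemma IsPriceProcess.stronglyMeasurable (h : IsPriceProcess P (expUtility γ) x f H Q S)
    (j : Fin J) {t : ℝ≥0} (ht : t ≤ T) : StronglyMeasurable[𝓕 t] (S j t) := by
  simpa only [min_eq_left ht] using (h.martingale_price j).1 t

lemma IsPriceProcess.ae_abs_le (h : IsPriceProcess P (expUtility γ) x f H Q S) {C : ℝ}
    (hC : ∀ j, ∀ᵐ ω ∂P, |f j ω| ≤ C) (j : Fin J) {t : ℝ≥0} (ht : t ≤ T) :
    ∀ᵐ ω ∂P, |S j t ω| ≤ C := by
  filter_upwards [h.ae_eq_condExp j ht,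
    h.absolutelyContinuous' (ae_abs_condExp_le (m := 𝓕 t) (h.absolutelyContinuous (hC j)))]
    with ω h1 h2
  rwa [h1]

lemma IsPriceProcess.memLp (h : IsPriceProcess P (expUtility γ) x f H Q S)
    (hf : ∀ j, MemLp (f j) ∞ P) (j : Fin J) {t : ℝ≥0} (ht : t ≤ T) : MemLp (S j t) ∞ P := by
  have := h.isProbabilityMeasure
  exact ((memLp_top_mono_ac h.absolutelyContinuous'
    (memLp_top_condExp (memLp_top_mono_ac h.absolutelyContinuous (hf j)))).ae_eq
      (h.ae_eq_condExp j ht).symm)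

lemma IsPriceProcess.isGridPrice (hγ : γ ≠ 0) (h : IsPriceProcess P (expUtility γ) x f H Q S)
    (hf : ∀ j, MemLp (f j) ∞ P) :
    IsGridPrice P 𝓕 H.gridTime (fun k j ω ↦ γ * H.gridPosition k j ω) f H.N 0
      (fun k j ↦ S j (H.gridTime k)) where
  stronglyMeasurable k j := h.stronglyMeasurable j (H.time_le _)
  memLp k j := h.memLp hf j (H.time_le _)
  price k _ _ j := by
    rw [← SimpleDemand.mul_gain_eq_logWeight, ← h.eq_tilted hγ]
    exact h.ae_eq_condExp j (H.time_le _)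

variable [IsProbabilityMeasure P]

/-- Both the pricing measure and, up to modification, the price process are unique. -/
lemma IsPriceProcess.unique (hγ : γ ≠ 0) (hH : H.IsBounded P) (hf : ∀ j, MemLp (f j) ∞ P)
    {Q' : Measure Ω} {S' : Fin J → ℝ≥0 → Ω → ℝ}
    (h : IsPriceProcess P (expUtility γ) x f H Q S)
    (h' : IsPriceProcess P (expUtility γ) x f H Q' S') :
    Q = Q' ∧ ∀ j, ∀ t ≤ T, S j t =ᵐ[P] S' j t := by
  have hQ : Q = Q' := by
    rw [h.eq_tilted hγ, h'.eq_tilted hγ]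
    refine tilted_congr ?_
    rw [SimpleDemand.mul_gain_eq_logWeight, SimpleDemand.mul_gain_eq_logWeight]
    exact (h.isGridPrice hγ hf).logWeight_ae_eq
      (fun k j ↦ (SimpleDemand.stronglyMeasurable_gridPosition k j).const_mul γ)
      (fun k j ↦ (SimpleDemand.memLp_gridPosition hH k j).const_mul γ) hf
      SimpleDemand.gridTime_mono (Nat.zero_le _) (h'.isGridPrice hγ hf)
  refine ⟨hQ, fun j t ht ↦ (h.ae_eq_condExp j ht).trans ?_⟩
  rw [hQ]
  exact (h'.ae_eq_condExp j ht).symm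

lemma exists_isPriceProcess (hγ : γ ≠ 0) (x : ℝ) (hH : H.IsBounded P)
    (hfm : ∀ j, Measurable[𝓕 T] (f j)) (hf : ∀ j, MemLp (f j) ∞ P) :
    ∃ Q S, IsPriceProcess P (expUtility γ) x f H Q S := by
  obtain ⟨s, hs⟩ := exists_isGridPrice (P := P) (f := f) (N := H.N) (i := 0)
    (fun k j ↦ (SimpleDemand.stronglyMeasurable_gridPosition (H := H) k j).const_mul γ)
    (fun k j ↦ (SimpleDemand.memLp_gridPosition hH k j).const_mul γ) hf
    SimpleDemand.gridTime_mono (Nat.zero_le _)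
  set g := logWeight (fun k j ω ↦ γ * H.gridPosition k j ω) s H.N 0 with hg
  have hgb : MemLp g ∞ P :=
    memLp_logWeight (fun k j ↦ (SimpleDemand.memLp_gridPosition hH k j).const_mul γ) hs.memLp 0
  have hexp := integrable_exp_of_memLp_top hgb
  set S : Fin J → ℝ≥0 → Ω → ℝ := fun j t ↦ (P.tilted g)[f j | 𝓕 t] with hS
  have hSb : ∀ j t, MemLp (S j t) ∞ P := fun j t ↦ memLp_condExp_tilted hgb (hf j)
  have hgain : (fun ω ↦ γ * H.gain S T ω) =ᵐ[P] g := by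
    rw [SimpleDemand.mul_gain_eq_logWeight, hg]
    have h1 : ∀ k : Fin (H.N + 1), ∀ j, s k j =ᵐ[P] S j (H.gridTime k) := fun k j ↦
      hs.price k (Nat.zero_le _) (Nat.lt_succ_iff.1 k.2) j
    filter_upwards [ae_all_iff.2 fun k ↦ ae_all_iff.2 (h1 k)] with ω hω
    simp only [logWeight, Finset.sum_apply]
    refine Finset.sum_congr rfl fun k hk ↦ Finset.sum_congr rfl fun j _ ↦ ?_
    have hk := (Finset.mem_Ico.1 hk).2
    rw [← hω ⟨k, by omega⟩ j, ← hω ⟨k + 1, by omega⟩ j]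
  have hac : P.tilted g ≪ P := tilted_absolutelyContinuous P g
  have hprob : IsProbabilityMeasure (P.tilted g) := isProbabilityMeasure_tilted hexp
  have hmart : ∀ j, IsMartingaleOn (P.tilted g) 𝓕 T (S j) := fun j ↦ by
    refine ⟨fun t ↦ stronglyMeasurable_condExp.mono (𝓕.mono (min_le_left t T)),
      fun s t hst ↦ ?_⟩
    have h1 := condExp_martingale_min (martingale_condExp (f j) 𝓕 (P.tilted g)) (min t T) s
    rwa [min_right_comm, min_eq_right hst] at h1
  refine ⟨P.tilted g, S, hprob, hac, absolutelyContinuous_tilted hexp, ?_, ?_, fun j ↦ ?_,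
    hmart, ?_⟩
  · simp only [deriv_expUtility_sub hγ]
    refine Integrable.const_mul ?_ _
    refine hexp.congr ?_
    filter_upwards [hgain] with ω hω
    rw [hω]
  · rw [withDensity_marginal_eq_tilted hγ, tilted_congr hgain]
  · simp only [hS]
    rw [condExp_of_stronglyMeasurable (𝓕.le T) (hfm j).stronglyMeasurable
      (memLp_top_integrable (memLp_top_mono_ac hac (hf j)))]
  · refine SimpleDemand.isMartingaleOn_gain ?_ hmart fun j t _ ↦ memLp_top_mono_ac hac (hSb j t)
    obtain ⟨C, hC⟩ := hH
    exact ⟨C, fun i j ↦ hac (hC i j)⟩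

/-- Without demand the pricing measure is the original one. -/
lemma IsPriceProcess.ae_eq_zeroPrice (hγ : γ ≠ 0)
    (h : IsPriceProcess P (expUtility γ) x f (H.scale 0) Q S) (j : Fin J) {t : ℝ≥0} (ht : t ≤ T) :
    S j t =ᵐ[P] zeroPrice P 𝓕 f j t := by
  have hQ : Q = P := by
    rw [h.eq_tilted hγ]
    simp [SimpleDemand.gain_scale]
  have := h.ae_eq_condExp j ht
  rwa [hQ] at this

end PriceProcess

/-! ### The first-order term and the covariation -/

section Covariation

variable {Ω : Type*} {mΩ : MeasurableSpace Ω} {P : Measure Ω} {𝓕 : Filtration ℝ≥0 mΩ}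
  {T : ℝ≥0}

lemma integrable_memLp_top_mul {θ X : Ω → ℝ} (hθ : MemLp θ ∞ P) (hX : Integrable X P) :
    Integrable (fun ω ↦ θ ω * X ω) P :=
  memLp_one_iff_integrable.1 (MemLp.mul' (memLp_one_iff_integrable.2 hX) hθ)

/-- Two random variables with the same conditional expectation given `m₂` can be exchanged under a
coarser conditional expectation, also after multiplication by an `m₂`-measurable factor. -/
lemma condExp_mul_congr_of_le {m₁ m₂ : MeasurableSpace Ω} [IsFiniteMeasure P] (h₁₂ : m₁ ≤ m₂)
    (h₂ : m₂ ≤ mΩ) {θ X Y : Ω → ℝ} (hθm : StronglyMeasurable[m₂] θ) (hθ : MemLp θ ∞ P)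
    (hX : Integrable X P) (hY : Integrable Y P) (hXY : P[X | m₂] =ᵐ[P] P[Y | m₂]) :
    P[fun ω ↦ θ ω * X ω | m₁] =ᵐ[P] P[fun ω ↦ θ ω * Y ω | m₁] := by
  have h : P[fun ω ↦ θ ω * X ω | m₂] =ᵐ[P] P[fun ω ↦ θ ω * Y ω | m₂] := by
    refine (condExp_mul_of_stronglyMeasurable_left hθm
      (integrable_memLp_top_mul hθ hX) hX).trans (EventuallyEq.trans ?_
      (condExp_mul_of_stronglyMeasurable_left hθm (integrable_memLp_top_mul hθ hY) hY).symm)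
    filter_upwards [hXY] with ω hω
    rw [Pi.mul_apply, Pi.mul_apply, hω]
  exact (condExp_condExp_of_le h₁₂ h₂).symm.trans
    ((condExp_congr_ae h).trans (condExp_condExp_of_le h₁₂ h₂))

lemma IsCovariation.integrable {M N A : ℝ≥0 → Ω → ℝ}
    (h : IsCovariation P 𝓕 T M N A) (hMN : ∀ t, Integrable (fun ω ↦ M t ω * N t ω) P) {t : ℝ≥0}
    (ht : t ≤ T) : Integrable (A t) P := by
  have h1 := h.martingale.integrable t
  simp only [min_eq_left ht] at h1
  refine ((hMN t).sub h1).congr (Eventually.of_forall fun ω ↦ ?_)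
  simp

variable [IsProbabilityMeasure P] {f h θ : Ω → ℝ} {A : ℝ≥0 → Ω → ℝ}

/-- Conditionally on the past, the product of a claim, net of its price at an earlier time `t`, with
a later increment of another price is the increment of the covariation. -/
lemma condExp_sub_mul_increment (hf : MemLp f ∞ P) (hh : MemLp h ∞ P)
    (hA : IsCovariation P 𝓕 T (fun t ↦ P[f | 𝓕 t]) (fun t ↦ P[h | 𝓕 t]) A) {t u v : ℝ≥0}
    (htu : t ≤ u) (huv : u ≤ v) (hv : v ≤ T) :
    P[fun ω ↦ (f ω - P[f | 𝓕 t] ω) * (P[h | 𝓕 v] ω - P[h | 𝓕 u] ω) | 𝓕 u]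
      =ᵐ[P] P[fun ω ↦ A v ω - A u ω | 𝓕 u] := by
  have hM : ∀ s, MemLp (P[f | 𝓕 s]) ∞ P := fun s ↦ memLp_top_condExp hf
  have hN : ∀ s, MemLp (P[h | 𝓕 s]) ∞ P := fun s ↦ memLp_top_condExp hh
  have hMN : ∀ s, Integrable (fun ω ↦ P[f | 𝓕 s] ω * P[h | 𝓕 s] ω) P := fun s ↦
    memLp_top_integrable (memLp_top_mul (hM s) (hN s))
  have hAi : ∀ s ≤ T, Integrable (A s) P := fun s hs ↦ hA.integrable hMN hs
  have hu := huv.trans hv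
  have hD : MemLp (fun ω ↦ P[h | 𝓕 v] ω - P[h | 𝓕 u] ω) ∞ P := (hN v).sub (hN u)
  -- the increment has zero conditional mean
  have hD0 : P[fun ω ↦ P[h | 𝓕 v] ω - P[h | 𝓕 u] ω | 𝓕 u] =ᵐ[P] 0 := by
    filter_upwards [condExp_sub (memLp_top_integrable (hN v)) (memLp_top_integrable (hN u)) (𝓕 u),
      condExp_martingale_min (martingale_condExp h 𝓕 P) v u,
      condExp_martingale_min (martingale_condExp h 𝓕 P) u u] with ω h1 h2 h3
    refine h1.trans ?_
    simp [h2, h3, min_eq_right huv]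
  have e1 : P[fun ω ↦ P[f | 𝓕 t] ω * (P[h | 𝓕 v] ω - P[h | 𝓕 u] ω) | 𝓕 u] =ᵐ[P] 0 := by
    refine (condExp_mul_of_stronglyMeasurable_left
      (stronglyMeasurable_condExp.mono (𝓕.mono htu))
      (memLp_top_integrable (memLp_top_mul (hM t) hD)) (memLp_top_integrable hD)).trans ?_
    filter_upwards [hD0] with ω hω
    simp [hω]
  -- the claim can be replaced by its price at the time of the second factor
  have e2 : ∀ s, u ≤ s → P[fun ω ↦ P[h | 𝓕 s] ω * f ω | 𝓕 u] =ᵐ[P]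
      P[fun ω ↦ P[h | 𝓕 s] ω * P[f | 𝓕 s] ω | 𝓕 u] := fun s hs ↦
    condExp_mul_congr_of_le (𝓕.mono hs) (𝓕.le s) stronglyMeasurable_condExp (hN s)
      (memLp_top_integrable hf) (memLp_top_integrable (hM s))
      (condExp_condExp_of_le le_rfl (𝓕.le s)).symm
  have e3 : P[fun ω ↦ P[h | 𝓕 u] ω * P[f | 𝓕 u] ω | 𝓕 u]
      = fun ω ↦ P[h | 𝓕 u] ω * P[f | 𝓕 u] ω :=
    condExp_of_stronglyMeasurable (𝓕.le u)
      (stronglyMeasurable_condExp.mul stronglyMeasurable_condExp)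
      (memLp_top_integrable (memLp_top_mul (hN u) (hM u)))
  have e4 := hA.martingale.2 u v huv
  simp only [min_eq_left hu, min_eq_left hv] at e4
  have e5 : P[A u | 𝓕 u] = A u :=
    condExp_of_stronglyMeasurable (𝓕.le u) (hA.adapted u hu).stronglyMeasurable (hAi u hu)
  have i1 := memLp_top_integrable (memLp_top_mul (hN v) hf)
  have i2 := memLp_top_integrable (memLp_top_mul (hN u) hf)
  have i3 := memLp_top_integrable (memLp_top_mul (hM t) hD)
  have hsplit : (fun ω ↦ (f ω - P[f | 𝓕 t] ω) * (P[h | 𝓕 v] ω - P[h | 𝓕 u] ω))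
      = ((fun ω ↦ P[h | 𝓕 v] ω * f ω) - fun ω ↦ P[h | 𝓕 u] ω * f ω)
        - fun ω ↦ P[f | 𝓕 t] ω * (P[h | 𝓕 v] ω - P[h | 𝓕 u] ω) := by
    ext ω; simp only [Pi.sub_apply]; ring
  have hcomm : (fun ω ↦ P[h | 𝓕 v] ω * P[f | 𝓕 v] ω) = fun ω ↦ P[f | 𝓕 v] ω * P[h | 𝓕 v] ω := by
    ext ω; ring
  rw [hsplit]
  filter_upwards [condExp_sub (i1.sub i2) i3 (𝓕 u), condExp_sub i1 i2 (𝓕 u), e1, e2 v huv,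
    e2 u le_rfl, e4, condExp_sub (hMN v) (hAi v hv) (𝓕 u),
    condExp_sub (hAi v hv) (hAi u hu) (𝓕 u)] with ω a1 a2 a3 a4 a5 a6 a7 a8
  rw [a1, Pi.sub_apply, a2, Pi.sub_apply, a3, a4, a5, e3, hcomm]
  refine Eq.trans ?_ a8.symm
  rw [Pi.sub_apply, e5]
  have a9 := a7.symm.trans a6
  simp only [Pi.sub_apply, Pi.zero_apply] at a9 ⊢
  linarith

/-- The conditional covariance at time `t` of a claim with the gains from holding the position `θ`
in another claim over `(u, v]`. Only the part of `(u, v]` after `t` contributes. -/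
lemma condExp_sub_mul_gain (hf : MemLp f ∞ P) (hh : MemLp h ∞ P)
    (hA : IsCovariation P 𝓕 T (fun t ↦ P[f | 𝓕 t]) (fun t ↦ P[h | 𝓕 t]) A) {t u v : ℝ≥0}
    (ht : t ≤ T) (huv : u ≤ v) (hv : v ≤ T) (hθm : StronglyMeasurable[𝓕 u] θ)
    (hθ : MemLp θ ∞ P) :
    P[fun ω ↦ (f ω - P[f | 𝓕 t] ω) * (θ ω * (P[h | 𝓕 v] ω - P[h | 𝓕 u] ω)) | 𝓕 t]
      =ᵐ[P] P[fun ω ↦ θ ω * (A (max t v) ω - A (max t u) ω) | 𝓕 t] := by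
  have hM : MemLp (P[f | 𝓕 t]) ∞ P := memLp_top_condExp hf
  have hN : ∀ s, MemLp (P[h | 𝓕 s]) ∞ P := fun s ↦ memLp_top_condExp hh
  have hAi : ∀ s ≤ T, Integrable (A s) P := fun s hs ↦ hA.integrable
    (fun s ↦ memLp_top_integrable (memLp_top_mul (memLp_top_condExp hf) (hN s))) hs
  have hD : MemLp (fun ω ↦ f ω - P[f | 𝓕 t] ω) ∞ P := hf.sub hM
  have hE : MemLp (fun ω ↦ P[h | 𝓕 (max t v)] ω - P[h | 𝓕 (max t u)] ω) ∞ P :=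
    (hN _).sub (hN _)
  -- the increment after `t`
  have e1 : P[fun ω ↦ θ ω * ((f ω - P[f | 𝓕 t] ω)
        * (P[h | 𝓕 (max t v)] ω - P[h | 𝓕 (max t u)] ω)) | 𝓕 t]
      =ᵐ[P] P[fun ω ↦ θ ω * (A (max t v) ω - A (max t u) ω) | 𝓕 t] :=
    condExp_mul_congr_of_le (𝓕.mono (le_max_left t u)) (𝓕.le _)
      (hθm.mono (𝓕.mono (le_max_right t u))) hθ (memLp_top_integrable (memLp_top_mul hD hE))
      ((hAi _ (max_le ht hv)).sub (hAi _ (max_le ht (huv.trans hv))))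
      (condExp_sub_mul_increment hf hh hA (le_max_left t u) (max_le_max_left t huv)
        (max_le ht hv))
  -- the increment before `t`
  have hW := (martingale_mul_sub (martingale_condExp h 𝓕 P) hN huv hθm hθ).1 t
  have hWb : MemLp (fun ω ↦ θ ω * (P[h | 𝓕 (min v t)] ω - P[h | 𝓕 (min u t)] ω)) ∞ P :=
    memLp_top_mul hθ ((hN _).sub (hN _))
  have e2 : P[fun ω ↦ (θ ω * (P[h | 𝓕 (min v t)] ω - P[h | 𝓕 (min u t)] ω))
      * (f ω - P[f | 𝓕 t] ω) | 𝓕 t] =ᵐ[P] 0 := by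
    refine (condExp_mul_of_stronglyMeasurable_left hW
      (memLp_top_integrable (memLp_top_mul hWb hD)) (memLp_top_integrable hD)).trans ?_
    filter_upwards [condExp_sub (memLp_top_integrable hf) (memLp_top_integrable hM) (𝓕 t),
      condExp_condExp_of_le (μ := P) (f := f) (le_refl (𝓕 t)) (𝓕.le t)] with ω h1 h2
    have h3 : P[fun ω ↦ f ω - P[f | 𝓕 t] ω | 𝓕 t] ω = 0 := by
      refine h1.trans ?_
      rw [Pi.sub_apply, h2, sub_self]
    rw [Pi.mul_apply, h3, mul_zero, Pi.zero_apply]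
  have hsplit : (fun ω ↦ (f ω - P[f | 𝓕 t] ω) * (θ ω * (P[h | 𝓕 v] ω - P[h | 𝓕 u] ω)))
      = (fun ω ↦ θ ω * ((f ω - P[f | 𝓕 t] ω)
        * (P[h | 𝓕 (max t v)] ω - P[h | 𝓕 (max t u)] ω)))
        + fun ω ↦ (θ ω * (P[h | 𝓕 (min v t)] ω - P[h | 𝓕 (min u t)] ω))
          * (f ω - P[f | 𝓕 t] ω) := by
    have hmm : ∀ s, (P[h | 𝓕 (max t s)]) + P[h | 𝓕 (min s t)] = P[h | 𝓕 s] + P[h | 𝓕 t] := by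
      intro s
      rcases le_total s t with hs | hs
      · rw [max_eq_left hs, min_eq_left hs, add_comm]
      · rw [max_eq_right hs, min_eq_right hs]
    ext ω
    have hv := congrFun (hmm v) ω
    have hu := congrFun (hmm u) ω
    simp only [Pi.add_apply] at hv hu ⊢
    linear_combination ((f ω - P[f | 𝓕 t] ω) * θ ω) * (hu - hv)
  rw [hsplit]
  filter_upwards [condExp_add (memLp_top_integrable (memLp_top_mul hθ (memLp_top_mul hD hE)))
    (memLp_top_integrable (memLp_top_mul hWb hD)) (𝓕 t), e1, e2] with ω h1 h2 h3
  rw [h1, Pi.add_apply, h2, h3, Pi.zero_apply, add_zero]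

end Covariation

section Bracket

variable {Ω : Type*} {mΩ : MeasurableSpace Ω} {P : Measure Ω} [IsProbabilityMeasure P]
  {𝓕 : Filtration ℝ≥0 mΩ} {T : ℝ≥0} {J : ℕ} {H : SimpleDemand 𝓕 T J} {f : Fin J → Ω → ℝ}
  {A : Fin J → Fin J → ℝ≥0 → Ω → ℝ}

lemma memLp_zeroPrice (hf : ∀ j, MemLp (f j) ∞ P) (j : Fin J) (t : ℝ≥0) :
    MemLp (zeroPrice P 𝓕 f j t) ∞ P := memLp_top_condExp (hf j)

lemma bracketIntegral_eq_sum (j : Fin J) (t : ℝ≥0) :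
    bracketIntegral H A j t = ∑ k, ∑ i : Fin H.N, fun ω ↦ H.θ i k ω *
      (A j k (max t (H.time i.succ)) ω - A j k (max t (H.time i.castSucc)) ω) := by
  ext ω
  simp [bracketIntegral, SimpleDemand.integral, H.time_le]

variable (hH : H.IsBounded P) (hf : ∀ j, MemLp (f j) ∞ P)
  (hA : ∀ j k, IsCovariation P 𝓕 T (zeroPrice P 𝓕 f j) (zeroPrice P 𝓕 f k) (A j k))
include hH hf hA

lemma integrable_bracketIntegral_term (j k : Fin J) (i : Fin H.N) {t : ℝ≥0} (ht : t ≤ T) :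
    Integrable (fun ω ↦ H.θ i k ω *
      (A j k (max t (H.time i.succ)) ω - A j k (max t (H.time i.castSucc)) ω)) P := by
  have hAi : ∀ s ≤ T, Integrable (A j k s) P := fun s hs ↦ (hA j k).integrable
    (fun s ↦ memLp_top_integrable (memLp_top_mul (memLp_zeroPrice hf j s)
      (memLp_zeroPrice hf k s))) hs
  exact integrable_memLp_top_mul (hH.memLp i k)
    ((hAi _ (max_le ht (H.time_le _))).sub (hAi _ (max_le ht (H.time_le _))))

lemma integrable_bracketIntegral (j : Fin J) {t : ℝ≥0} (ht : t ≤ T) :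
    Integrable (bracketIntegral H A j t) P := by
  rw [bracketIntegral_eq_sum]
  exact integrable_finsetSum' _ fun k _ ↦ integrable_finsetSum' _ fun i _ ↦
    integrable_bracketIntegral_term hH hf hA j k i ht

/-- The conditional covariance of the `j`-th claim with the gains made at the prices for zero
demand. -/
lemma condExp_sub_mul_gain_zeroPrice (j : Fin J) {t : ℝ≥0} (ht : t ≤ T) :
    P[fun ω ↦ (f j ω - zeroPrice P 𝓕 f j t ω) * H.gain (zeroPrice P 𝓕 f) T ω | 𝓕 t]
      =ᵐ[P] P[bracketIntegral H A j t | 𝓕 t] := by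
  have hX : ∀ (k : Fin J) (i : Fin H.N), Integrable (fun ω ↦ (f j ω - zeroPrice P 𝓕 f j t ω) *
      (H.θ i k ω * (zeroPrice P 𝓕 f k (H.time i.succ) ω
        - zeroPrice P 𝓕 f k (H.time i.castSucc) ω))) P := fun k i ↦
    memLp_top_integrable (memLp_top_mul ((hf j).sub (memLp_zeroPrice hf j t))
      (memLp_top_mul (hH.memLp i k) ((memLp_zeroPrice hf k _).sub (memLp_zeroPrice hf k _))))
  have hsum : (fun ω ↦ (f j ω - zeroPrice P 𝓕 f j t ω) * H.gain (zeroPrice P 𝓕 f) T ω)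
      = ∑ k, ∑ i : Fin H.N, fun ω ↦ (f j ω - zeroPrice P 𝓕 f j t ω) *
      (H.θ i k ω * (zeroPrice P 𝓕 f k (H.time i.succ) ω
        - zeroPrice P 𝓕 f k (H.time i.castSucc) ω)) := by
    ext ω
    simp [SimpleDemand.gain_final, Finset.mul_sum]
  rw [hsum, bracketIntegral_eq_sum]
  refine (condExp_finsetSum (fun k _ ↦ integrable_finsetSum' _ fun i _ ↦ hX k i) _).trans
    (EventuallyEq.trans ?_ (condExp_finsetSum (fun k _ ↦ integrable_finsetSum' _ fun i _ ↦
      integrable_bracketIntegral_term hH hf hA j k i ht) _).symm)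
  refine eventuallyEq_sum fun k _ ↦ ?_
  refine (condExp_finsetSum (fun i _ ↦ hX k i) _).trans
    (EventuallyEq.trans ?_ (condExp_finsetSum (fun i _ ↦
      integrable_bracketIntegral_term hH hf hA j k i ht) _).symm)
  refine eventuallyEq_sum fun i _ ↦ ?_
  exact condExp_sub_mul_gain (hf j) (hf k) (hA j k) ht (H.time_castSucc_le i) (H.time_le _)
    (H.stronglyMeasurable_θ i k) (hH.memLp i k)

end Bracket

/-! ### The remainder is of second order, uniformly -/

section Expansion

variable {Ω : Type*} {mΩ : MeasurableSpace Ω} {P : Measure Ω} {𝓕 : Filtration ℝ≥0 mΩ}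
  {T : ℝ≥0} {J : ℕ} {H : SimpleDemand 𝓕 T J} {f : Fin J → Ω → ℝ}

lemma SimpleDemand.gain_sub (S S' : Fin J → ℝ≥0 → Ω → ℝ) (ω : Ω) :
    H.gain (fun j t ω ↦ S j t ω - S' j t ω) T ω = H.gain S T ω - H.gain S' T ω := by
  simp only [gain_final, ← Finset.sum_sub_distrib]
  refine Finset.sum_congr rfl fun k _ ↦ Finset.sum_congr rfl fun i _ ↦ ?_
  ring

/-- Gains at bounded prices are bounded, linearly in the bound for the prices. -/
lemma SimpleDemand.IsBounded.exists_abs_gain_le (hH : H.IsBounded P) :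
    ∃ L : ℝ, 0 ≤ L ∧ ∀ (S : Fin J → ℝ≥0 → Ω → ℝ) (K : ℝ),
      (∀ j, ∀ t ≤ T, ∀ᵐ ω ∂P, |S j t ω| ≤ K) → ∀ᵐ ω ∂P, |H.gain S T ω| ≤ L * K := by
  obtain ⟨C, hC⟩ := hH
  refine ⟨∑ _k : Fin J, ∑ _i : Fin H.N, |C| * 2, by positivity, fun S K hS ↦ ?_⟩
  filter_upwards [ae_all_iff.2 fun i ↦ ae_all_iff.2 (hC i),
    ae_all_iff.2 fun j ↦ ae_all_iff.2 fun i ↦ hS j (H.time i) (H.time_le i)] with ω hθ hSω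
  rw [gain_final, Finset.sum_mul]
  refine (Finset.abs_sum_le_sum_abs _ _).trans (Finset.sum_le_sum fun k _ ↦ ?_)
  rw [Finset.sum_mul]
  refine (Finset.abs_sum_le_sum_abs _ _).trans (Finset.sum_le_sum fun i _ ↦ ?_)
  rw [abs_mul, mul_assoc]
  refine mul_le_mul ((hθ i k).trans (le_abs_self C)) ?_ (abs_nonneg _) (abs_nonneg _)
  have h1 := hSω k i.succ
  have h2 := hSω k i.castSucc
  have h3 := abs_sub (S k (H.time i.succ) ω) (S k (H.time i.castSucc) ω)
  linarith

variable [IsProbabilityMeasure P]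

/-- The price impact `X - E[Y | m]` as the conditional covariance of the pricing error with the
density, where `X` is the price of `Y` under the measure tilted by `g`. -/
lemma sub_condExp_ae_eq {m : MeasurableSpace Ω} (hm : m ≤ mΩ) {g X Y : Ω → ℝ}
    (hXm : StronglyMeasurable[m] X) (hg : MemLp g ∞ P) (hX : MemLp X ∞ P) (hY : MemLp Y ∞ P)
    (hXY : X =ᵐ[P] (P.tilted g)[Y | m]) :
    (fun ω ↦ X ω - P[Y | m] ω) =ᵐ[P]
      P[fun ω ↦ (Y ω - X ω) * (Real.exp (g ω) - 1) | m] := by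
  have hsplit : (fun ω ↦ (Y ω - X ω) * (Real.exp (g ω) - 1))
      = (fun ω ↦ (Y ω - X ω) * Real.exp (g ω)) - (Y - X) := by
    ext ω; simp only [Pi.sub_apply]; ring
  rw [hsplit]
  filter_upwards [condExp_sub (memLp_top_integrable
      (memLp_top_mul (hY.sub hX) (memLp_top_exp hg))) (memLp_top_integrable (hY.sub hX)) m,
    condExp_sub (memLp_top_integrable hY) (memLp_top_integrable hX) m,
    condExp_sub_mul_exp_eq_zero hm hg hX hY hXY] with ω h1 h2 h3
  have h4 : P[X | m] = X := condExp_of_stronglyMeasurable hm hXm (memLp_top_integrable hX)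
  have h5 := h1.trans (congrArg₂ (· - ·) h3 h2)
  rw [h4] at h5
  refine Eq.trans ?_ h5.symm
  simp only [Pi.sub_apply, Pi.zero_apply]
  ring

/-- The pointwise estimate behind the expansion. -/
lemma abs_remainder_le {a b C d ε y X X₀ g g₀ : ℝ} (hε : 0 < ε) (hC : 0 ≤ C) (hy : |y| ≤ C)
    (hX : |X| ≤ C) (hg : |g| ≤ a * ε) (hg1 : |g| ≤ 1) (hg₀ : |g₀| ≤ a)
    (hX₀ : |X - X₀| ≤ b * ε) (hgg : |g - ε * g₀| ≤ d * ε ^ 2) :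
    |(y - X) * (Real.exp g - 1) - ε * ((y - X₀) * g₀)|
      ≤ (2 * C * (a ^ 2 + d) + b * a) * ε ^ 2 := by
  have h1 : (y - X) * (Real.exp g - 1) - ε * ((y - X₀) * g₀)
      = (y - X) * ((Real.exp g - 1 - g) + (g - ε * g₀)) + ε * (-(X - X₀) * g₀) := by ring
  have h2 : |y - X| ≤ 2 * C := (abs_sub y X).trans (by linarith)
  have h3 : |(Real.exp g - 1 - g) + (g - ε * g₀)| ≤ (a ^ 2 + d) * ε ^ 2 := by
    have h4 : g ^ 2 ≤ (a * ε) ^ 2 := sq_le_sq' (neg_le_of_abs_le hg) (le_of_abs_le hg)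
    have h5 := Real.abs_exp_sub_one_sub_id_le hg1
    refine (abs_add_le _ _).trans ?_
    nlinarith
  have h6 : |-(X - X₀) * g₀| ≤ b * ε * a := by
    rw [abs_mul, abs_neg]
    exact mul_le_mul hX₀ hg₀ (abs_nonneg _) ((abs_nonneg _).trans hX₀)
  rw [h1]
  refine (abs_add_le _ _).trans ?_
  rw [abs_mul, abs_mul, abs_of_pos hε]
  have h7 := mul_le_mul h2 h3 (abs_nonneg _) (by positivity)
  have h8 := mul_le_mul_of_nonneg_left h6 hε.le
  linarith

/-- For small demand, the prices differ from their first-order expansion by `O(ε²)`, uniformly. -/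
lemma exists_abs_remainder_le {γ : ℝ} (hγ : 0 < γ) (x : ℝ) (hH : H.IsBounded P)
    (hfm : ∀ j, Measurable (f j)) (hfb : ∃ C : ℝ, ∀ j, ∀ᵐ ω ∂P, |f j ω| ≤ C)
    {A : Fin J → Fin J → ℝ≥0 → Ω → ℝ}
    (hA : ∀ j k, IsCovariation P 𝓕 T (zeroPrice P 𝓕 f j) (zeroPrice P 𝓕 f k) (A j k)) :
    ∃ K ε₀ : ℝ, 0 ≤ K ∧ 0 < ε₀ ∧ ∀ ε, 0 < ε → ε < ε₀ → ∀ Q S,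
      IsPriceProcess P (expUtility γ) x f (H.scale ε) Q S → ∀ j, ∀ t ≤ T, ∀ᵐ ω ∂P,
        |S j t ω - zeroPrice P 𝓕 f j t ω
          - ε * (P[fun ω' ↦ γ * bracketIntegral H A j t ω' | 𝓕 t]) ω| ≤ K * ε ^ 2 := by
  obtain ⟨C, hC0, hC⟩ : ∃ C : ℝ, 0 ≤ C ∧ ∀ j, ∀ᵐ ω ∂P, |f j ω| ≤ C := by
    obtain ⟨C, hC⟩ := hfb
    exact ⟨|C|, abs_nonneg C, fun j ↦ (hC j).mono fun ω hω ↦ hω.trans (le_abs_self C)⟩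
  have hf : ∀ j, MemLp (f j) ∞ P := fun j ↦
    memLp_top_of_bound (hfm j).aestronglyMeasurable C (hC j)
  obtain ⟨L, hL0, hL⟩ := hH.exists_abs_gain_le
  -- `a ε` bounds the exponent of the density, `b ε` the price impact and `d ε²` the error of
  -- computing the exponent at the prices for zero demand
  set a := γ * (L * C) with ha
  set b := 2 * C * (2 * a) with hb
  set d := γ * (L * b) with hd
  have ha0 : 0 ≤ a := by positivity
  refine ⟨2 * C * (a ^ 2 + d) + b * a, 1 / (a + 1), by positivity, by positivity,
    fun ε hε hε₀ Q S hS j t ht ↦ ?_⟩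
  have haε : a * ε ≤ 1 := by
    rw [lt_div_iff₀ (by positivity)] at hε₀
    nlinarith
  set g : Ω → ℝ := fun ω ↦ γ * (H.scale ε).gain S T ω with hg
  set g₀ : Ω → ℝ := fun ω ↦ γ * H.gain (zeroPrice P 𝓕 f) T ω with hg₀
  have hSb : ∀ j, ∀ t ≤ T, MemLp (S j t) ∞ P := fun j t ht ↦ hS.memLp hf j ht
  have hgm : MemLp g ∞ P := (SimpleDemand.memLp_gain (hH.scale ε) hSb).const_mul γ
  have hg₀m : MemLp g₀ ∞ P :=
    (SimpleDemand.memLp_gain hH fun j t _ ↦ memLp_zeroPrice hf j t).const_mul γ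
  have hgε : ∀ ω, g ω = ε * (γ * H.gain S T ω) := fun ω ↦ by
    simp only [hg, SimpleDemand.gain_scale]; ring
  have hgb : ∀ᵐ ω ∂P, |g ω| ≤ a * ε := by
    filter_upwards [hL S C fun j t ht ↦ hS.ae_abs_le hC j ht] with ω hω
    rw [hgε, abs_mul, abs_mul, abs_of_pos hε, abs_of_pos hγ]
    have := mul_le_mul_of_nonneg_left hω (mul_pos hε hγ).le
    linarith
  have hg₀b : ∀ᵐ ω ∂P, |g₀ ω| ≤ a := by
    filter_upwards [hL (zeroPrice P 𝓕 f) C fun j t _ ↦ ae_abs_condExp_le (hC j)] with ω hω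
    rw [hg₀, abs_mul, abs_of_pos hγ]
    exact mul_le_mul_of_nonneg_left hω hγ.le
  have hdiff : ∀ j, ∀ t ≤ T, (fun ω ↦ S j t ω - zeroPrice P 𝓕 f j t ω) =ᵐ[P]
      P[fun ω ↦ (f j ω - S j t ω) * (Real.exp (g ω) - 1) | 𝓕 t] := fun j t ht ↦ by
    refine sub_condExp_ae_eq (𝓕.le t) (hS.stronglyMeasurable j ht) hgm (hSb j t ht) (hf j) ?_
    rw [hg, ← hS.eq_tilted hγ.ne']
    exact hS.ae_eq_condExp j ht
  have himpact : ∀ j, ∀ t ≤ T, ∀ᵐ ω ∂P, |S j t ω - zeroPrice P 𝓕 f j t ω| ≤ b * ε :=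
      fun j t ht ↦ by
    have h1 : ∀ᵐ ω ∂P, |(f j ω - S j t ω) * (Real.exp (g ω) - 1)| ≤ b * ε := by
      filter_upwards [hC j, hS.ae_abs_le hC j ht, hgb] with ω h1 h2 h3
      have h4 := Real.abs_exp_sub_one_le (h3.trans haε)
      have h5 : |f j ω - S j t ω| ≤ 2 * C := (abs_sub _ _).trans (by linarith)
      rw [abs_mul]
      refine (mul_le_mul h5 (h4.trans (mul_le_mul_of_nonneg_left h3 zero_le_two))
        (abs_nonneg _) (by positivity)).trans_eq ?_
      rw [hb]; ring
    filter_upwards [hdiff j t ht, ae_abs_condExp_le (m := 𝓕 t) h1] with ω h2 h3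
    rwa [h2]
  have hgg : ∀ᵐ ω ∂P, |g ω - ε * g₀ ω| ≤ d * ε ^ 2 := by
    filter_upwards [hL (fun j t ω ↦ S j t ω - zeroPrice P 𝓕 f j t ω) (b * ε) himpact] with ω hω
    rw [SimpleDemand.gain_sub] at hω
    have h1 : g ω - ε * g₀ ω
        = (ε * γ) * (H.gain S T ω - H.gain (zeroPrice P 𝓕 f) T ω) := by
      rw [hgε, hg₀]; ring
    rw [h1, abs_mul, abs_of_pos (mul_pos hε hγ)]
    refine (mul_le_mul_of_nonneg_left hω (mul_pos hε hγ).le).trans_eq ?_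
    rw [hd]; ring
  have hbound : ∀ᵐ ω ∂P, |(f j ω - S j t ω) * (Real.exp (g ω) - 1)
      - ε * ((f j ω - zeroPrice P 𝓕 f j t ω) * g₀ ω)|
        ≤ (2 * C * (a ^ 2 + d) + b * a) * ε ^ 2 := by
    filter_upwards [hC j, hS.ae_abs_le hC j ht, hgb, hg₀b, himpact j t ht, hgg]
      with ω h1 h2 h3 h4 h5 h6
    exact abs_remainder_le hε hC0 h1 h2 h3 (h3.trans haε) h4 h5 h6
  have hZ : MemLp (fun ω ↦ (f j ω - zeroPrice P 𝓕 f j t ω) * g₀ ω) ∞ P :=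
    memLp_top_mul ((hf j).sub (memLp_zeroPrice hf j t)) hg₀m
  have hY : MemLp (fun ω ↦ (f j ω - S j t ω) * (Real.exp (g ω) - 1)) ∞ P :=
    memLp_top_mul ((hf j).sub (hSb j t ht)) ((memLp_top_exp hgm).sub (memLp_const 1))
  have hfirst : P[fun ω ↦ ε * ((f j ω - zeroPrice P 𝓕 f j t ω) * g₀ ω) | 𝓕 t] =ᵐ[P]
      fun ω ↦ ε * (P[fun ω' ↦ γ * bracketIntegral H A j t ω' | 𝓕 t]) ω := by
    have h1 : (fun ω ↦ ε * ((f j ω - zeroPrice P 𝓕 f j t ω) * g₀ ω)) = (ε * γ) •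
        fun ω ↦ (f j ω - zeroPrice P 𝓕 f j t ω) * H.gain (zeroPrice P 𝓕 f) T ω := by
      ext ω; simp only [hg₀, Pi.smul_apply, smul_eq_mul]; ring
    rw [h1]
    filter_upwards [condExp_smul (μ := P) (ε * γ) (fun ω ↦
        (f j ω - zeroPrice P 𝓕 f j t ω) * H.gain (zeroPrice P 𝓕 f) T ω) (𝓕 t),
      condExp_sub_mul_gain_zeroPrice hH hf hA j ht,
      condExp_smul (μ := P) γ (bracketIntegral H A j t) (𝓕 t)] with ω h2 h3 h4
    rw [h2, Pi.smul_apply, h3, smul_eq_mul, mul_assoc]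
    exact congrArg (ε * ·) h4.symm
  filter_upwards [hdiff j t ht, hfirst, ae_abs_condExp_le (m := 𝓕 t) hbound,
    condExp_sub (memLp_top_integrable hY) (memLp_top_integrable (hZ.const_mul ε)) (𝓕 t)]
    with ω h1 h2 h3 h4
  rw [h1, ← h2]
  exact (congrArg abs h4).symm.trans_le h3

end Expansion

/-- Functions that are `O(ε²)` almost surely are `o(ε)` in probability. -/
lemma tendstoInMeasure_div_of_abs_le_sq {Ω : Type*} {mΩ : MeasurableSpace Ω} {P : Measure Ω}
    {ξ : ℝ → Ω → ℝ} {K ε₀ : ℝ} (hK : 0 ≤ K) (hε₀ : 0 < ε₀)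
    (h : ∀ ε, 0 < ε → ε < ε₀ → ∀ᵐ ω ∂P, |ξ ε ω| ≤ K * ε ^ 2) :
    TendstoInMeasure P (fun ε ω ↦ ξ ε ω / ε) (𝓝[>] (0 : ℝ)) fun _ ↦ 0 := by
  rw [tendstoInMeasure_iff_norm]
  intro δ hδ
  have hev : ∀ᶠ ε in 𝓝[>] (0 : ℝ), ε ∈ Set.Ioo 0 (min ε₀ (δ / (K + 1))) :=
    Ioo_mem_nhdsGT (lt_min hε₀ (by positivity))
  refine tendsto_const_nhds.congr' ?_
  filter_upwards [hev] with ε hε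
  have h1 : ε < ε₀ := hε.2.trans_le (min_le_left _ _)
  have h2 : ε * (K + 1) < δ := (lt_div_iff₀ (by positivity)).1 (hε.2.trans_le (min_le_right _ _))
  symm
  rw [measure_eq_zero_iff_ae_notMem]
  filter_upwards [h ε hε.1 h1] with ω hω hmem
  have hε0 : 0 < ε := hε.1
  have h3 : δ ≤ |ξ ε ω| / ε := by simpa [abs_div, abs_of_pos hε0] using hmem
  rw [le_div_iff₀ hε0] at h3
  nlinarith

end LargeInvestor

theorem theorem3p2 {Ω : Type*} {mΩ : MeasurableSpace Ω} (P : Measure Ω) [IsProbabilityMeasure P]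
    {J : ℕ} (T : ℝ≥0) (hT : 0 < T)
    (B : Fin J → ℝ≥0 → Ω → ℝ) (hB : LargeInvestor.IsBrownianOn P T B)
    (𝓕 : Filtration ℝ≥0 mΩ) (h𝓕 : LargeInvestor.IsGeneratedBy P T 𝓕 B)
    (γ : ℝ) (hγ : 0 < γ) (x : ℝ)
    (f : Fin J → Ω → ℝ) (hf : ∀ j, Measurable[𝓕 T] (f j))
    (hfb : ∃ C : ℝ, ∀ j, ∀ᵐ ω ∂P, |f j ω| ≤ C)
    (H : LargeInvestor.SimpleDemand 𝓕 T J) (hH : H.IsBounded P) :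
    -- the price under `ε H` is well defined up to modification, and so is the pricing measure
    (∀ ε : ℝ, 0 < ε →
      (∃ Q S, LargeInvestor.IsPriceProcess P (LargeInvestor.expUtility γ) x f (H.scale ε) Q S) ∧
      ∀ Q S Q' S',
        LargeInvestor.IsPriceProcess P (LargeInvestor.expUtility γ) x f (H.scale ε) Q S →
        LargeInvestor.IsPriceProcess P (LargeInvestor.expUtility γ) x f (H.scale ε) Q' S' →
        Q = Q' ∧ ∀ j, ∀ t ≤ T, S j t =ᵐ[P] S' j t) ∧
    -- `S⁰` is the price under zero demand
    (∀ Q S, LargeInvestor.IsPriceProcess P (LargeInvestor.expUtility γ) x f (H.scale 0) Q S →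
      ∀ j, ∀ t ≤ T, S j t =ᵐ[P] LargeInvestor.zeroPrice P 𝓕 f j t) ∧
    -- the expansion
    ∀ (Q : ℝ → Measure Ω) (S : ℝ → Fin J → ℝ≥0 → Ω → ℝ) (A : Fin J → Fin J → ℝ≥0 → Ω → ℝ),
      (∀ ε : ℝ, 0 < ε → LargeInvestor.IsPriceProcess P (LargeInvestor.expUtility γ) x f
        (H.scale ε) (Q ε) (S ε)) →
      (∀ j k, LargeInvestor.IsCovariation P 𝓕 T (LargeInvestor.zeroPrice P 𝓕 f j)
        (LargeInvestor.zeroPrice P 𝓕 f k) (A j k)) →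
      (∀ j, ∀ t ≤ T, Integrable (LargeInvestor.bracketIntegral H A j t) P) ∧
      ∃ ξ : ℝ → Fin J → ℝ≥0 → Ω → ℝ,
        (∀ ε : ℝ, 0 < ε → ∀ j, ∀ t ≤ T, ∀ᵐ ω ∂P,
          S ε j t ω = LargeInvestor.zeroPrice P 𝓕 f j t ω
            + ε * (P[fun ω' ↦ γ * LargeInvestor.bracketIntegral H A j t ω' | 𝓕 t]) ω
            + ξ ε j t ω) ∧
        ∀ j, ∀ t ≤ T,
          TendstoInMeasure P (fun ε ω ↦ ξ ε j t ω / ε) (𝓝[>] (0 : ℝ)) fun _ ↦ 0 := by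
  have ⟨C, hC⟩ := hfb
  have hfm : ∀ j, Measurable (f j) := fun j ↦ (hf j).mono (𝓕.le T) le_rfl
  have hfL : ∀ j, MemLp (f j) ∞ P := fun j ↦
    memLp_top_of_bound (hfm j).aestronglyMeasurable C (hC j)
  refine ⟨fun ε _ ↦ ⟨LargeInvestor.exists_isPriceProcess hγ.ne' x (hH.scale ε) hf hfL,
    fun Q S Q' S' h h' ↦ h.unique hγ.ne' (hH.scale ε) hfL h'⟩,
    fun Q S h j t ht ↦ h.ae_eq_zeroPrice hγ.ne' j ht, fun Q S A hS hA ↦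
    ⟨fun j t ht ↦ LargeInvestor.integrable_bracketIntegral hH hfL hA j ht,
      fun ε j t ω ↦ S ε j t ω - LargeInvestor.zeroPrice P 𝓕 f j t ω
        - ε * (P[fun ω' ↦ γ * LargeInvestor.bracketIntegral H A j t ω' | 𝓕 t]) ω,
      fun ε _ j t _ ↦ Eventually.of_forall fun ω ↦ by ring, fun j t ht ↦ ?_⟩⟩
  obtain ⟨K, ε₀, hK, hε₀, h⟩ :=
    LargeInvestor.exists_abs_remainder_le hγ x hH hfm hfb hA
  exact LargeInvestor.tendstoInMeasure_div_of_abs_le_sq hK hε₀ fun ε hε hεε ↦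
    h ε hε hεε (Q ε) (S ε) (hS ε hε) j t ht
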